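/- Let $X$ be an infinite Hausdorff space, and let $\mathscr{F}(X)$ be the set of all nonempty closed subsets of $X$, endowed with the Vietoris topology, i.e. the topology generated by the sets $\langle\mathscr{V}\rangle=\{S\in\mathscr{F}(X): S\subset\bigcup\mathscr{V}\text{ and } S\cap V\neq\emptyset\text{ for every }V\in\mathscr{V}\}$, where $\mathscr{V}$ runs over the finite families of open subsets of $X$. A continuous selection for $\mathscr{F}(X)$ is a continuous map $f:\mathscr{F}(X)\to X$ with $f(S)\in S$ for every $S\in\mathscr{F}(X)$. Let $X_\Theta$ be the set of all points $f(X)$, where $f$ is a continuous selection for $\mathscr{F}(X)$. A point $p\in X$ is - a butterfly point if $\overline{F\setminus\{p\}}\cap\overline{G\setminus\{p\}}=\{p\}$ for some closed sets $F,G\subset X$; - countably-approachable if either $p$ is isolated, or there is an open set $U\subset X\setminus\{p\}$ with $\overline{U}=U\cup\{p\}$ such that $p$ has a countable local base in the subspace $\overline{U}$ consisting of clopen subsets of $\overline{U}$. Let $X_\Omega$ be the set of all countably-approachable points of $X$. The space $X$ is totally disconnected at $p$ if $\{p\}$ is an intersection of clopen subsets of $X$. If $p\in X_\Theta$ is a butterfly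 point and $X$ is totally disconnected at $p$, then $p\in X_\Omega$, i.e. $p$ is countably-approachable. -/

import Mathlib

open Set Topology

namespace Gutev

/-- The set `𝓕(X)` of all nonempty closed subsets of `X`. -/
def Hyperspace (X : Type*) [TopologicalSpace X] : Type _ :=
  {S : Set X // IsClosed S ∧ S.Nonempty}

/-- The Vietoris topology on `𝓕(X)`: the topology induced by the Vietoris topology on the
powerset of `X`, whose basic open sets are
`⟨𝓥⟩ = {S | S ⊆ ⋃ 𝓥 and S ∩ V ≠ ∅ for every V ∈ 𝓥}`, with `𝓥` a finite family of open sets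
(see `TopologicalSpace.vietoris.isTopologicalBasis`). -/
instance Hyperspace.instTopologicalSpace (X : Type*) [TopologicalSpace X] :
    TopologicalSpace (Hyperspace X) :=
  TopologicalSpace.induced Subtype.val (TopologicalSpace.vietoris X)

/-- The whole space `X`, as an element of `𝓕(X)`. -/
def Hyperspace.whole (X : Type*) [TopologicalSpace X] [Nonempty X] : Hyperspace X :=
  ⟨univ, isClosed_univ, univ_nonempty⟩

/-- The set of all continuous selections for `𝓕(X)`. -/
def continuousSelections (X : Type*) [TopologicalSpace X] : Set (Hyperspace X → X) :=
  {f | Continuous f ∧ ∀ S : Hyperspace X, f S ∈ S.val}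

/-- `X_Θ`, the set of all points `f(X)` where `f` is a continuous selection for `𝓕(X)`. -/
def thetaSet (X : Type*) [TopologicalSpace X] [Nonempty X] : Set X :=
  {p | ∃ f ∈ continuousSelections X, f (Hyperspace.whole X) = p}

/-- The point `p` has a countable clopen base in the space `Y`: there is a countable local base
at `p` that consists of clopen subsets of `Y`. -/
def HasCountableClopenBaseAt {Y : Type*} [TopologicalSpace Y] (p : Y) : Prop :=
  ∃ B : Set (Set Y), B.Countable ∧ (∀ W ∈ B, IsClopen W ∧ p ∈ W) ∧
    ∀ O : Set Y, IsOpen O → p ∈ O → ∃ W ∈ B, W ⊆ O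

/-- `p` is countably-approachable: it is isolated, or it has a countable clopen base in the
subspace `closure U`, for some open `U ⊆ X \ {p}` with `closure U = U ∪ {p}`. -/
def IsCountablyApproachable {X : Type*} [TopologicalSpace X] (p : X) : Prop :=
  IsOpen ({p} : Set X) ∨
    ∃ U : Set X, IsOpen U ∧ U ⊆ {p}ᶜ ∧ closure U = U ∪ {p} ∧
      ∃ hp : p ∈ closure U, HasCountableClopenBaseAt (⟨p, hp⟩ : closure U)

/-- `X_Ω`, the set of all countably-approachable points of `X`. -/
def omegaSet (X : Type*) [TopologicalSpace X] : Set X :=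
  {p | IsCountablyApproachable p}

/-- `p` is a butterfly point. -/
def IsButterflyPoint {X : Type*} [TopologicalSpace X] (p : X) : Prop :=
  ∃ F G : Set X, IsClosed F ∧ IsClosed G ∧ closure (F \ {p}) ∩ closure (G \ {p}) = {p}

/-- `X` is totally disconnected at `p`: the singleton `{p}` is an intersection of clopen sets. -/
def IsTotallyDisconnectedAt {X : Type*} [TopologicalSpace X] (p : X) : Prop :=
  ∃ C : Set (Set X), (∀ W ∈ C, IsClopen W) ∧ ⋂₀ C = {p}

end Gutev

/-! Let `g` be a selection with `g univ = p`. It suffices to find nonempty clopen sets missing `p`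
that converge to `p`. Each is made of values `g E` with `E` squeezed between a set `A n` and a
closed `L ⊇ A n`; if the `A n` converge to `L` and `g L = p`, continuity forces these values towards
`p`. The proof splits on whether `g (C ∪ {p}) = p` for all large clopen `C` missing `p`.

If so, add points of the two butterfly wings alternately to a growing sequence of clopen sets. The
selected points lie in both wings infinitely often, so the limit value lies in both closures and
must be `p` (`isCountablyApproachable_of_forall`).

If not, `p` can be thickened to a clopen `Z` with `g (C ∪ Z) ∈ C`. Iterating gives sets `C n ∪ Z n`
converging to the whole space, where `g` selects `p` (`isCountablyApproachable_of_exists`). -/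

namespace Gutev

open Filter

attribute [local instance] TopologicalSpace.vietoris

variable {X : Type*} [TopologicalSpace X]

/-! ### Selections and the clopen sets they produce -/

/-- A selection for the nonempty closed sets that is continuous in the Vietoris topology, extended
arbitrarily to all sets. -/
structure IsClosedSelection (g : Set X → X) : Prop where
  mem : ∀ S : Set X, IsClosed S → S.Nonempty → g S ∈ S
  continuousOn : ContinuousOn g {S | IsClosed S ∧ S.Nonempty}

theorem exists_isClosedSelection [Nonempty X] {p : X} (hp : p ∈ thetaSet X) :
    ∃ g : Set X → X, IsClosedSelection g ∧ g univ = p := by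
  classical
  obtain ⟨f, ⟨hf, hsel⟩, rfl⟩ := hp
  let g : Set X → X := fun S =>
    if h : IsClosed S ∧ S.Nonempty then f ⟨S, h⟩ else f (Hyperspace.whole X)
  have hgf : ∀ (S : Set X) (h : IsClosed S ∧ S.Nonempty), g S = f ⟨S, h⟩ := fun S h => dif_pos h
  refine ⟨g, ⟨fun S hS hne => ?_, ?_⟩, hgf univ ⟨isClosed_univ, univ_nonempty⟩⟩
  · rw [hgf S ⟨hS, hne⟩]
    exact hsel ⟨S, hS, hne⟩
  · rw [continuousOn_iff_continuous_domRestrict]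
    have : Set.domRestrict {S | IsClosed S ∧ S.Nonempty} g = f := by
      funext S
      exact hgf S.1 S.2
    rw [this]
    exact hf

namespace IsClosedSelection

variable {g : Set X → X}

/-- If the sets `A i` converge to the closed set `L` from inside, then `g` takes values close to
`g L` at all closed sets between `A i` and `L`. -/
theorem eventually_forall_between (hg : IsClosedSelection g) {ι : Type*} {l : Filter ι}
    {A : ι → Set X} {L O : Set X} (hL : IsClosed L) (hne : L.Nonempty)
    (hA : ∀ G, IsOpen G → (L ∩ G).Nonempty → ∀ᶠ i in l, (A i ∩ G).Nonempty)
    (hO : IsOpen O) (hgL : g L ∈ O) :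
    ∀ᶠ i in l, ∀ E, IsClosed E → A i ⊆ E → E ⊆ L → g E ∈ O := by
  have h := hg.continuousOn L ⟨hL, hne⟩ (hO.mem_nhds hgL)
  rw [mem_map, mem_nhdsWithin_iff_exists_mem_nhds_inter] at h
  obtain ⟨N, hN, hNO⟩ := h
  obtain ⟨_, ⟨u, ⟨hufin, huo⟩, rfl⟩, ⟨hLu, hLm⟩, huN⟩ :=
    TopologicalSpace.vietoris.isTopologicalBasis.mem_nhds_iff.1 hN
  have h1 : ∀ᶠ i in l, ∀ U ∈ u, (A i ∩ U).Nonempty :=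
    (eventually_all_finite hufin).2 fun U hU => hA U (huo U hU) (hLm U hU)
  -- The inclusion `E ⊆ L` keeps `E` inside the union of the Vietoris neighbourhood, and `A i ⊆ E`
  -- makes it meet each member.
  filter_upwards [h1, hA univ isOpen_univ (by simpa using hne)] with i hi hi' E hE hAE hEL
  refine hNO ⟨huN ⟨hEL.trans hLu, fun U hU => (hi U hU).mono ?_⟩, hE, ?_⟩
  · exact inter_subset_inter_left _ hAE
  · exact (hi'.mono inter_subset_left).mono hAE

theorem continuous_union_singleton [T1Space X] (hg : IsClosedSelection g) {K : Set X}
    (hK : IsClosed K) : Continuous fun y => g (K ∪ {y}) :=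
  hg.continuousOn.comp_continuous
    (TopologicalSpace.vietoris.continuous_union.comp
      (continuous_const.prodMk TopologicalSpace.vietoris.continuous_singleton))
    fun y => ⟨hK.union isClosed_singleton, y, Or.inr rfl⟩

/-- A maximal closed subset `Z` of `D` with `g (K ∪ Z) ∈ K` is clopen. -/
theorem exists_isClopen_superset [T1Space X] (hg : IsClosedSelection g) {K D Z₀ : Set X}
    (hK : IsClopen K) (hD : IsClopen D) (hZ₀ : IsClosed Z₀) (hZD : Z₀ ⊆ D)
    (hgZ : g (K ∪ Z₀) ∈ K) :
    ∃ Z, IsClopen Z ∧ Z₀ ⊆ Z ∧ Z ⊆ D ∧ g (K ∪ Z) ∈ K := by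
  have hKne : K.Nonempty := ⟨_, hgZ⟩
  obtain ⟨Z, hZ₀Z, ⟨hZc, hZD, hgZ⟩, hmax⟩ := zorn_subset_nonempty
    {Z | IsClosed Z ∧ Z ⊆ D ∧ g (K ∪ Z) ∈ K} (by
      intro c hc hchain hcne
      have hL : IsClosed (K ∪ closure (⋃₀ c)) := hK.isClosed.union isClosed_closure
      refine ⟨closure (⋃₀ c), ⟨isClosed_closure, ?_, ?_⟩,
        fun s hs => (subset_sUnion_of_mem hs).trans subset_closure⟩
      · exact closure_minimal (sUnion_subset fun s hs => (hc hs).2.1) hD.isClosed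
      · by_contra hcon
        have : Nonempty c := hcne.to_subtype
        have : IsDirectedOrder c :=
          ⟨fun a b => (directedOn_iff_directed.1 hchain.directedOn) a b⟩
        obtain ⟨i, hi⟩ := (hg.eventually_forall_between (l := atTop)
          (A := fun i : c => K ∪ i.1) hL (hKne.mono subset_union_left) (by
            rintro G hG ⟨x, hxK | hxc, hxG⟩
            · exact Eventually.of_forall fun i => ⟨x, Or.inl hxK, hxG⟩
            · obtain ⟨y, hyG, s, hs, hys⟩ := mem_closure_iff.1 hxc G hG hxG
              filter_upwards [eventually_ge_atTop (⟨s, hs⟩ : c)] with i hi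
              exact ⟨y, Or.inr (hi hys), hyG⟩)
          hK.isClosed.isOpen_compl hcon).exists
        refine hi (K ∪ i.1) (hK.isClosed.union (hc i.2).1) subset_rfl ?_ (hc i.2).2.2
        exact union_subset_union_right _ ((subset_sUnion_of_mem i.2).trans subset_closure))
    Z₀ ⟨hZ₀, hZD, hgZ⟩
  refine ⟨Z, ?_, hZ₀Z, hZD, hgZ⟩
  -- By maximality `Z` already contains every `y ∈ D` that can be added without moving the selected
  -- point out of `K`; this condition is clopen in `y`.
  have hZo : Z = D ∩ (fun y => g (K ∪ Z ∪ {y})) ⁻¹' K := by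
    ext z
    refine ⟨fun hz => ⟨hZD hz, ?_⟩, fun hz => ?_⟩
    · rw [mem_preimage, union_assoc, union_eq_self_of_subset_right (singleton_subset_iff.2 hz)]
      exact hgZ
    · refine hmax (y := Z ∪ {z}) ⟨hZc.union isClosed_singleton, ?_, ?_⟩ subset_union_left
        (Or.inr rfl)
      · exact union_subset hZD (singleton_subset_iff.2 hz.1)
      · rw [← union_assoc]
        exact hz.2
  rw [hZo]
  exact hD.inter (hK.preimage (hg.continuous_union_singleton (hK.isClosed.union hZc)))

/-- Delete the selected point from `T` repeatedly. Once `T` is empty the selected point lies in `K`,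
so it enters `K` at some stage; `t` is the point deleted just before. -/
theorem exists_finset_union_singleton (hg : IsClosedSelection g) [T1Space X] {K D : Set X}
    (hK : IsClosed K) (T : Finset X) (hTD : ↑T ⊆ D) (hKne : K.Nonempty) (hgT : g (K ∪ T) ∉ K) :
    ∃ T' : Finset X, ↑T' ⊆ D ∧ g (K ∪ T') ∈ K ∧ ∃ t ∈ D, g (K ∪ T' ∪ {t}) = t := by
  classical
  induction T using Finset.strongInduction with
  | H T ih =>
    have ht : g (K ∪ T) ∈ T :=
      (hg.mem (K ∪ T) (hK.union T.finite_toSet.isClosed) (hKne.mono subset_union_left)).resolve_left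
        hgT
    have hsub : ↑(T.erase (g (K ∪ T))) ⊆ D := (Finset.coe_subset.2 (T.erase_subset _)).trans hTD
    by_cases h : g (K ∪ ↑(T.erase (g (K ∪ T)))) ∈ K
    · refine ⟨T.erase (g (K ∪ T)), hsub, h, g (K ∪ T), hTD ht, ?_⟩
      rw [union_assoc, union_singleton, ← Finset.coe_insert, Finset.insert_erase ht]
    · exact ih _ (Finset.erase_ssubset ht) hsub h

/-- If `g` selects from `K ∪ D` a point of `D`, then the points of some nonempty clopen subset of
`D` are all selected from closed sets between `K` and `K ∪ D`. -/
theorem exists_isClopen_selected [T2Space X] (hg : IsClosedSelection g) {K D : Set X}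
    (hK : IsClosed K) (hKne : K.Nonempty) (hD : IsClopen D) (hKD : Disjoint K D)
    (hgD : g (K ∪ D) ∈ D) :
    ∃ V, IsClopen V ∧ V.Nonempty ∧ V ⊆ D ∧
      ∀ y ∈ V, ∃ E, IsClosed E ∧ K ⊆ E ∧ E ⊆ K ∪ D ∧ g E = y := by
  classical
  obtain ⟨T, hT⟩ := (hg.eventually_forall_between (l := atTop)
    (A := fun T : Finset D => K ∪ ↑(T.map (Function.Embedding.subtype _)))
    (hK.union hD.isClosed) (hKne.mono subset_union_left) (by
      rintro G hG ⟨x, hxK | hxD, hxG⟩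
      · exact Eventually.of_forall fun i => ⟨x, Or.inl hxK, hxG⟩
      · filter_upwards [eventually_ge_atTop ({⟨x, hxD⟩} : Finset D)] with T hT
        exact ⟨x, Or.inr (by simpa [hxD] using hT), hxG⟩) hD.isOpen hgD).exists
  have hTD : (↑(T.map (Function.Embedding.subtype _)) : Set X) ⊆ D := by
    intro x hx
    simp only [Finset.coe_map, mem_image] at hx
    obtain ⟨y, -, rfl⟩ := hx
    exact y.2
  have hgT := hT (K ∪ ↑(T.map (Function.Embedding.subtype _)))
    (hK.union (Finset.finite_toSet _).isClosed) subset_rfl (union_subset_union_right _ hTD)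
  obtain ⟨T', hT'D, hgT', t, htD, hgt⟩ := hg.exists_finset_union_singleton hK _ hTD hKne
    fun h => hKD.le_bot ⟨h, hgT⟩
  have hKT : IsClosed (K ∪ ↑T') := hK.union T'.finite_toSet.isClosed
  have hcont := hg.continuous_union_singleton hKT
  have hmem : ∀ y, g (K ∪ T' ∪ {y}) = y → y ∈ D → y ∉ (T' : Set X) := by
    intro y hy hyD hyT
    rw [union_assoc, union_eq_self_of_subset_right (singleton_subset_iff.2 hyT)] at hy
    exact hKD.le_bot ⟨hgT', hy ▸ hyD⟩
  -- Closedness is the Hausdorff property. For openness: `y` is the only candidate for a value in `D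
  -- \ T'`, because `K` misses `D`.
  have hVo : D ∩ {y | g (K ∪ T' ∪ {y}) = y} =
      D ∩ (fun y => g (K ∪ T' ∪ {y})) ⁻¹' (D \ T') := by
    ext y
    refine and_congr_right fun hyD => ⟨fun hy => ?_, fun hy => ?_⟩
    · have hy' : g (K ∪ T' ∪ {y}) = y := hy
      rw [mem_preimage, hy']
      exact ⟨hyD, hmem y hy hyD⟩
    · rcases hg.mem (K ∪ T' ∪ {y}) (hKT.union isClosed_singleton) ⟨y, Or.inr rfl⟩ with (h | h) | h
      · exact (hKD.le_bot ⟨h, hy.1⟩).elim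
      · exact (hy.2 h).elim
      · exact h
  refine ⟨D ∩ {y | g (K ∪ T' ∪ {y}) = y}, ⟨?_, ?_⟩, ⟨t, htD, hgt⟩, inter_subset_left, ?_⟩
  · exact hD.isClosed.inter (isClosed_eq hcont continuous_id)
  · rw [hVo]
    exact hD.isOpen.inter ((hD.isOpen.sdiff T'.finite_toSet.isClosed).preimage hcont)
  · rintro y ⟨hyD, hy⟩
    refine ⟨K ∪ T' ∪ {y}, hKT.union isClosed_singleton, ?_, ?_, hy⟩
    · exact subset_union_left.trans subset_union_left
    · exact union_subset (union_subset_union_right _ hT'D)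
        (singleton_subset_iff.2 (Or.inr hyD))

end IsClosedSelection

/-! ### From convergent clopen sets to countable approachability -/

/-- The limit of a sequence of nonempty clopen sets that do not contain it is
countably-approachable. -/
theorem isCountablyApproachable_of_isClopen [T2Space X] {p : X} {V : ℕ → Set X}
    (hV : ∀ n, IsClopen (V n)) (hne : ∀ n, (V n).Nonempty) (hpV : ∀ n, p ∉ V n)
    (hlim : ∀ O, IsOpen O → p ∈ O → ∀ᶠ n in atTop, V n ⊆ O) : IsCountablyApproachable p := by
  have hcl : closure (⋃ n, V n) = (⋃ n, V n) ∪ {p} := by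
    apply subset_antisymm
    · intro x hx
      by_contra hcon
      have hxV : ∀ n, x ∉ V n := fun n h => hcon (Or.inl (mem_iUnion.2 ⟨n, h⟩))
      obtain ⟨O, O', hO, hO', hxO, hpO', hd⟩ := t2_separation (show x ≠ p from fun h =>
        hcon (Or.inr h))
      obtain ⟨N, hN⟩ := eventually_atTop.1 (hlim O' hO' hpO')
      obtain ⟨y, ⟨hyO, hy⟩, hyV⟩ := mem_closure_iff.1 hx (O ∩ (⋃ n ∈ Finset.range N, V n)ᶜ)
        (hO.inter (isClosed_biUnion_finset fun n _ => (hV n).isClosed).isOpen_compl)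
        ⟨hxO, by simpa using fun n _ => hxV n⟩
      obtain ⟨n, hyn⟩ := mem_iUnion.1 hyV
      rcases lt_or_ge n N with h | h
      · exact hy (mem_biUnion (Finset.mem_coe.2 (Finset.mem_range.2 h)) hyn)
      · exact hd.le_bot ⟨hyO, hN n h hyn⟩
    · refine union_subset subset_closure (singleton_subset_iff.2 (mem_closure_iff.2 ?_))
      intro O hO hpO
      obtain ⟨n, hn⟩ := (hlim O hO hpO).exists
      obtain ⟨y, hy⟩ := hne n
      exact ⟨y, hn hy, mem_iUnion.2 ⟨n, hy⟩⟩
  have hp : p ∈ closure (⋃ n, V n) := hcl ▸ Or.inr rfl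
  refine Or.inr ⟨⋃ n, V n, isOpen_iUnion fun n => (hV n).isOpen, ?_, hcl, hp, ?_⟩
  · exact iUnion_subset fun n y hy h => hpV n (mem_singleton_iff.1 h ▸ hy)
  -- The local base consists of the complements of the finite partial unions.
  refine ⟨range fun N : ℕ => Subtype.val ⁻¹' (⋃ n ∈ Finset.range N, V n)ᶜ,
    countable_range _, ?_, ?_⟩
  · rintro _ ⟨N, rfl⟩
    refine ⟨IsClopen.preimage ?_ continuous_subtype_val, by simpa using fun n _ => hpV n⟩
    exact (isClopen_biUnion_finset fun n _ => hV n).compl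
  · intro O hO hpO
    obtain ⟨O', hO', rfl⟩ := isOpen_induced_iff.1 hO
    obtain ⟨N, hN⟩ := eventually_atTop.1 (hlim O' hO' hpO)
    refine ⟨_, ⟨N, rfl⟩, ?_⟩
    rintro ⟨x, hx⟩ hxN
    rw [hcl] at hx
    rcases hx with hx | rfl
    · obtain ⟨n, hxn⟩ := mem_iUnion.1 hx
      rcases lt_or_ge n N with h | h
      · exact (hxN (mem_biUnion (Finset.mem_coe.2 (Finset.mem_range.2 h)) hxn)).elim
      · exact hN n h hxn
    · exact hpO

theorem IsTotallyDisconnectedAt.exists_isClopen {p : X} (hd : IsTotallyDisconnectedAt p)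
    {C : Set X} (hC : IsClopen C) (hpC : p ∉ C) {x : X} (hx : x ≠ p) :
    ∃ C', IsClopen C' ∧ p ∉ C' ∧ C ⊆ C' ∧ x ∈ C' := by
  obtain ⟨𝒲, h𝒲, hp⟩ := hd
  have hx' : x ∉ ⋂₀ 𝒲 := by rwa [hp]
  have hp' : p ∈ ⋂₀ 𝒲 := by rw [hp]; rfl
  rw [mem_sInter] at hx' hp'
  push Not at hx'
  obtain ⟨W, hW, hxW⟩ := hx'
  exact ⟨C ∪ Wᶜ, hC.union (h𝒲 W hW).compl, by simp [hpC, hp' W hW], subset_union_left, Or.inr hxW⟩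

theorem eventually_inter_nonempty_of_monotone {C : ℕ → Set X} (hC : Monotone C) {G : Set X}
    {x : X} (hx : x ∈ closure (⋃ n, C n)) (hG : IsOpen G) (hxG : x ∈ G) :
    ∀ᶠ n in atTop, (C n ∩ G).Nonempty := by
  obtain ⟨y, hyG, hy⟩ := mem_closure_iff.1 hx G hG hxG
  obtain ⟨m, hm⟩ := mem_iUnion.1 hy
  filter_upwards [eventually_ge_atTop m] with n hn
  exact ⟨y, hC hn hm, hyG⟩

/-! ### The two cases -/

/-- If `g` selects `p` from `C ∪ {p}` for all large clopen sets `C` missing `p`, and `p` is a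
butterfly point, then `p` is countably-approachable. -/
theorem IsClosedSelection.isCountablyApproachable_of_forall [T2Space X] {g : Set X → X} {p : X}
    (hg : IsClosedSelection g) (hb : IsButterflyPoint p) (hd : IsTotallyDisconnectedAt p)
    {C₀ : Set X} (hC₀ : IsClopen C₀) (hpC₀ : p ∉ C₀)
    (hmax : ∀ C, IsClopen C → p ∉ C → C₀ ⊆ C → g (C ∪ {p}) = p) :
    IsCountablyApproachable p := by
  obtain ⟨F, G, -, -, hFG⟩ := hb
  have hpFG : p ∈ closure (F \ {p}) ∩ closure (G \ {p}) := hFG.symm ▸ mem_singleton p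
  -- For admissible `C`, `N C` is a clopen neighbourhood of `p` whose points are selected when added
  -- to `C`.
  let N : Set X → Set X := fun C => Cᶜ ∩ {y | g (C ∪ {y}) = y}
  have hN : ∀ C, IsClopen C → IsClopen (N C) := by
    intro C hC
    have hcont := hg.continuous_union_singleton hC.isClosed
    refine ⟨hC.compl.isClosed.inter (isClosed_eq hcont continuous_id), ?_⟩
    have : N C = Cᶜ ∩ (fun y => g (C ∪ {y})) ⁻¹' Cᶜ := by
      ext y
      refine and_congr_right fun hyC => ⟨fun hy => ?_, fun hy => ?_⟩
      · have hy' : g (C ∪ {y}) = y := hy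
        rwa [mem_preimage, hy']
      · exact (hg.mem (C ∪ {y}) (hC.isClosed.union isClosed_singleton)
          ⟨y, Or.inr rfl⟩).resolve_left hy
    rw [this]
    exact hC.compl.isOpen.inter (hC.compl.isOpen.preimage hcont)
  let P := {C : Set X // IsClopen C ∧ p ∉ C ∧ C₀ ⊆ C}
  let H : ℕ → Set X := fun n => if Even n then F else G
  have hstep : ∀ (n : ℕ) (C : P), ∃ C' : P, C.1 ⊆ C'.1 ∧ ∃ t ∈ H n, t ∈ N C.1 ∧ t ∈ C'.1 := by
    rintro n ⟨C, hC, hpC, hCC⟩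
    have hpH : p ∈ closure (H n \ {p}) := by
      by_cases h : Even n
      · simpa [H, h] using hpFG.1
      · simpa [H, h] using hpFG.2
    obtain ⟨t, htN, htH, htp⟩ := mem_closure_iff.1 hpH (N C) (hN C hC).isOpen
      ⟨hpC, hmax C hC hpC hCC⟩
    obtain ⟨C', hC', hpC', hsub, htC'⟩ := hd.exists_isClopen hC hpC htp
    exact ⟨⟨C', hC', hpC', hCC.trans hsub⟩, hsub, t, htH, htN, htC'⟩
  choose next hnext t htH htN htC using hstep
  let C : ℕ → P := fun n => Nat.rec ⟨C₀, hC₀, hpC₀, subset_rfl⟩ next n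
  have hmono : Monotone fun n => (C n).1 := monotone_nat_of_le_succ fun n => hnext n (C n)
  have htn : ∀ n, t n (C n) ∈ (C (n + 1)).1 := fun n => htC n (C n)
  let L := closure (⋃ n, (C n).1)
  have hCL : ∀ n, (C n).1 ⊆ L := fun n =>
    (subset_iUnion (fun n => (C n).1) n).trans subset_closure
  have hev : ∀ O, IsOpen O → g L ∈ O →
      ∀ᶠ n in atTop, ∀ E, IsClosed E → (C n).1 ⊆ E → E ⊆ L → g E ∈ O := by
    intro O hO hgO
    refine hg.eventually_forall_between (L := L) isClosed_closure ⟨_, hCL 1 (htn 0)⟩ ?_ hO hgO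
    rintro W hW ⟨x, hxL, hxW⟩
    exact eventually_inter_nonempty_of_monotone hmono hxL hW hxW
  have hsel : ∀ O, IsOpen O → g L ∈ O → ∀ᶠ n in atTop,
      ∀ y ∈ N (C n).1 ∩ (C (n + 1)).1, y ∈ O := by
    intro O hO hgO
    filter_upwards [hev O hO hgO] with n hn y hy
    have := hn ((C n).1 ∪ {y}) ((C n).2.1.isClosed.union isClosed_singleton) subset_union_left
      (union_subset (hCL n) (singleton_subset_iff.2 (hCL (n + 1) hy.2)))
    rwa [hy.1.2] at this
  have htp : ∀ n, t n (C n) ≠ p := fun n => ne_of_mem_of_not_mem (htn n) (C (n + 1)).2.2.1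
  -- The points `t n (C n) = g (C n ∪ {t n (C n)})` converge to `g L`; even indices lie in `F \ {p}`
  -- and odd ones in `G \ {p}`.
  have hgL : g L = p := by
    have : g L ∈ closure (F \ {p}) ∩ closure (G \ {p}) := by
      refine ⟨mem_closure_iff.2 fun O hO hgO => ?_, mem_closure_iff.2 fun O hO hgO => ?_⟩
      all_goals obtain ⟨n, hn⟩ := eventually_atTop.1 (hsel O hO hgO)
      · refine ⟨t (2 * n) (C (2 * n)), hn _ (by lia) _ ⟨htN _ _, htn _⟩, ?_, htp _⟩
        have := htH (2 * n) (C (2 * n))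
        rwa [show H (2 * n) = F from if_pos (even_two_mul n)] at this
      · refine ⟨t (2 * n + 1) (C (2 * n + 1)), hn _ (by lia) _ ⟨htN _ _, htn _⟩, ?_, htp _⟩
        have := htH (2 * n + 1) (C (2 * n + 1))
        rwa [show H (2 * n + 1) = G from
          if_neg (Nat.not_even_iff_odd.2 (odd_two_mul_add_one n))] at this
    rwa [hFG] at this
  refine isCountablyApproachable_of_isClopen (V := fun n => N (C n).1 ∩ (C (n + 1)).1)
    (fun n => (hN _ (C n).2.1).inter (C (n + 1)).2.1) (fun n => ⟨_, htN _ _, htn n⟩)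
    (fun n h => (C (n + 1)).2.2.1 h.2) fun O hO hpO => ?_
  exact hsel O hO (hgL ▸ hpO)

/-- If `g` selects `p` from the whole space, but there are arbitrarily large clopen sets `C` missing
`p` such that `g` does not select `p` from `C ∪ {p}`, then `p` is countably-approachable. -/
theorem IsClosedSelection.isCountablyApproachable_of_exists [T2Space X] {g : Set X → X} {p : X}
    (hg : IsClosedSelection g) (hp : g univ = p)
    (hbad : ∀ C₀, IsClopen C₀ → p ∉ C₀ → ∃ C, IsClopen C ∧ p ∉ C ∧ C₀ ⊆ C ∧ g (C ∪ {p}) ≠ p) :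
    IsCountablyApproachable p := by
  let P := {C : Set X // IsClopen C ∧ p ∉ C ∧ g (C ∪ {p}) ≠ p}
  have hZ : ∀ C : P, ∃ Z, IsClopen Z ∧ p ∈ Z ∧ Z ⊆ C.1ᶜ ∧ g (C.1 ∪ Z) ∈ C.1 := by
    rintro ⟨C, hC, hpC, hgC⟩
    obtain ⟨Z, hZ, hpZ, hZC, hgZ⟩ := hg.exists_isClopen_superset hC hC.compl isClosed_singleton
      (singleton_subset_iff.2 hpC) ((hg.mem (C ∪ {p}) (hC.isClosed.union isClosed_singleton)
        ⟨p, Or.inr rfl⟩).resolve_right hgC)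
    exact ⟨Z, hZ, singleton_subset_iff.1 hpZ, hZC, hgZ⟩
  choose Z hZ hpZ hZC hgZ using hZ
  have hstep : ∀ C : P, ∃ C' : P, (Z C)ᶜ ⊆ C'.1 := by
    intro C
    obtain ⟨C', hC', hpC', hsub, hg'⟩ := hbad (Z C)ᶜ (hZ C).compl (fun h => h (hpZ C))
    exact ⟨⟨C', hC', hpC', hg'⟩, hsub⟩
  choose next hnext using hstep
  obtain ⟨C₁, hC₁, hpC₁, -, hgC₁⟩ := hbad ∅ isClopen_empty (notMem_empty p)
  let C : ℕ → P := fun n => Nat.rec ⟨C₁, hC₁, hpC₁, hgC₁⟩ (fun _ => next) n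
  have hCs : ∀ n, (Z (C n))ᶜ ⊆ (C (n + 1)).1 := fun n => hnext (C n)
  have hmono : Monotone fun n => (C n).1 := monotone_nat_of_le_succ fun n =>
    (subset_compl_comm.1 (hZC (C n))).trans (hCs n)
  have hanti : Antitone fun n => Z (C n) := antitone_nat_of_succ_le fun n =>
    (hZC (C (n + 1))).trans (compl_subset_comm.1 (hCs n))
  -- Points outside every `C n` lie in every `Z (C j)`, so `C n ∪ Z (C (k n))` converges to the
  -- whole space however `k` is chosen. It is used for `id` and then for the `k` built below.
  have hev : ∀ k : ℕ → ℕ, ∀ O, IsOpen O → p ∈ O → ∀ᶠ n in atTop,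
      ∀ E, IsClosed E → (C n).1 ∪ Z (C (k n)) ⊆ E → g E ∈ O := by
    intro k O hO hpO
    filter_upwards [hg.eventually_forall_between (A := fun n => (C n).1 ∪ Z (C (k n)))
      isClosed_univ ⟨p, trivial⟩ (l := atTop) (by
        rintro G hG ⟨x, -, hxG⟩
        by_cases hx : ∃ n, x ∈ (C n).1
        · obtain ⟨m, hm⟩ := hx
          filter_upwards [eventually_ge_atTop m] with n hn
          exact ⟨x, Or.inl (hmono hn hm), hxG⟩
        · refine Eventually.of_forall fun n => ⟨x, Or.inr ?_, hxG⟩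
          by_contra h
          exact hx ⟨k n + 1, hCs (k n) h⟩) hO (hp.symm ▸ hpO : g univ ∈ O)] with n hn E hE hsub
    exact hn E hE hsub (subset_univ E)
  have hk : ∀ m, ∃ k, m ≤ k ∧ g ((C k).1 ∪ Z (C k)) ∉ (C m).1 := by
    intro m
    obtain ⟨N, hN⟩ := eventually_atTop.1 (hev id _ (C m).2.1.compl.isOpen (C m).2.2.1)
    refine ⟨max N m, le_max_right _ _, hN _ (le_max_left _ _) _ ?_ subset_rfl⟩
    exact (C _).2.1.isClosed.union (hZ _).isClosed
  choose k hmk hk using hk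
  have hV : ∀ m, ∃ V, IsClopen V ∧ V.Nonempty ∧ V ⊆ (C (k m)).1 \ (C m).1 ∧
      ∀ y ∈ V, ∃ E, IsClosed E ∧ (C m).1 ∪ Z (C (k m)) ⊆ E ∧ g E = y := by
    intro m
    -- The point selected from `C (k m) ∪ Z (C (k m))` lies in `C (k m)` but not in `C m`, so
    -- `exists_isClopen_selected` applies with the difference as `D`.
    have hun : (C m).1 ∪ Z (C (k m)) ∪ ((C (k m)).1 \ (C m).1) = (C (k m)).1 ∪ Z (C (k m)) := by
      rw [union_right_comm, union_sdiff_cancel (hmono (hmk m))]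
    have hdis : Disjoint ((C m).1 ∪ Z (C (k m))) ((C (k m)).1 \ (C m).1) :=
      disjoint_union_left.2 ⟨disjoint_sdiff_self_right,
        (disjoint_left.2 fun x hx hx' => hZC _ hx hx'.1)⟩
    obtain ⟨V, hV, hVne, hVsub, hVE⟩ := hg.exists_isClopen_selected
      ((C m).2.1.isClosed.union (hZ (C (k m))).isClosed) ⟨p, Or.inr (hpZ _)⟩
      ((C (k m)).2.1.diff (C m).2.1) hdis (by rw [hun]; exact ⟨hgZ _, hk m⟩)
    refine ⟨V, hV, hVne, hVsub, fun y hy => ?_⟩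
    obtain ⟨E, hE, hsub, -, hgE⟩ := hVE y hy
    exact ⟨E, hE, hsub, hgE⟩
  choose V hV hVne hVsub hVE using hV
  refine isCountablyApproachable_of_isClopen hV hVne
    (fun m h => (C (k m)).2.2.1 (hVsub m h).1) fun O hO hpO => ?_
  filter_upwards [hev k O hO hpO] with m hm y hy
  obtain ⟨E, hE, hsub, rfl⟩ := hVE m y hy
  exact hm E hE hsub

end Gutev

theorem corollary1p3 {X : Type*} [TopologicalSpace X] [T2Space X] [Infinite X] (p : X)
    (hp : p ∈ Gutev.thetaSet X) (hb : Gutev.IsButterflyPoint p)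
    (hd : Gutev.IsTotallyDisconnectedAt p) :
    p ∈ Gutev.omegaSet X := by
  obtain ⟨g, hg, hgp⟩ := Gutev.exists_isClosedSelection hp
  by_cases h : ∃ C₀, IsClopen C₀ ∧ p ∉ C₀ ∧
      ∀ C, IsClopen C → p ∉ C → C₀ ⊆ C → g (C ∪ {p}) = p
  · obtain ⟨C₀, hC₀, hpC₀, hmax⟩ := h
    exact hg.isCountablyApproachable_of_forall hb hd hC₀ hpC₀ hmax
  · push Not at h
    exact hg.isCountablyApproachable_of_exists hgp h
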